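/- Let $R$ be a commutative Noetherian local ring with maximal ideal $\mathfrak m$ and residue field $k$. For a complex $X=\cdots\to X_n\to X_{n-1}\to\cdots$ of $R$-modules put $$\dim_R X=\sup\{\dim(R/\mathfrak p)-\inf H(X)_{\mathfrak p}\mid \mathfrak p\in\operatorname{Spec}R\},\qquad \inf H(X)_{\mathfrak p}=\inf\{n\in\mathbb Z\mid H_n(X)_{\mathfrak p}\neq 0\},$$ where $\inf\varnothing=\infty$ and $\sup\varnothing=-\infty$. An $R$-module $M$ is a big Cohen--Macaulay module if $\operatorname{depth}_R M=\dim R$, where $\operatorname{depth}_RM=\inf\{n\mid \operatorname{Ext}^n_R(k,M)\ne0\}$, and $\mathfrak mM\neq M$; it is balanced if moreover every system of parameters for $R$ is an $M$-regular sequence. Let $F=0\to F_b\to\cdots\to F_0\to 0$ be a complex of free $R$-modules of finite rank, and let $\operatorname{Hom}_R(F,R)$ be the complex with $\operatorname{Hom}_R(F_n,R)$ in degree $-n$. If $\dim R-\dim_R\operatorname{Hom}_R(F,R)\ge 0$, then for every balanced big Cohen--Macaulay $R$-module $M$ one has $H_i(F\otimes_R M)=0$ for all $i\ge 1$. -/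

import Mathlib

open CategoryTheory
open scoped TensorProduct ENNReal

universe u v w

noncomputable section

namespace FreeComplex

variable {R : Type u} [CommRing R]

/-- A finite free complex `0 → F_b → ⋯ → F_a → 0`: a complex of `R`-modules (lower grading)
concentrated in degrees `[a, b]` whose components are free of finite rank. -/
structure IsFiniteFree (F : ChainComplex (ModuleCat.{v} R) ℤ) (a b : ℤ) : Prop where
  free : ∀ n, Module.Free R (F.X n)
  finite : ∀ n, Module.Finite R (F.X n)
  zero_of_lt : ∀ n, n < a → Subsingleton (F.X n)
  zero_of_gt : ∀ n, b < n → Subsingleton (F.X n)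

/-- The complex `Hom_R(F, R)`: its component in degree `n` is `Hom_R(F_{-n}, R)`, and its
differential `Hom_R(F_{-n}, R) → Hom_R(F_{1-n}, R)` is precomposition with the differential
`F_{1-n} → F_{-n}`. -/
def dual (F : ChainComplex (ModuleCat.{v} R) ℤ) :
    ChainComplex (ModuleCat.{max u v} R) ℤ where
  X n := ModuleCat.of R (F.X (-n) →ₗ[R] R)
  d i j := ModuleCat.ofHom (LinearMap.lcomp R R (F.d (-j) (-i)).hom)
  shape i j hij := by
    have h : F.d (-j) (-i) = 0 := F.shape _ _ (by
      simp only [ComplexShape.down_Rel] at hij ⊢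
      omega)
    ext f x
    simp [h]
  d_comp_d' i j k _ _ := by
    ext f x
    have h : (F.d (-j) (-i)).hom ((F.d (-k) (-j)).hom x) = 0 := by
      rw [← LinearMap.comp_apply, ← ModuleCat.hom_comp, F.d_comp_d]
      simp
    simp [h]

/-- The complex `F ⊗_R M`, for a module `M`. -/
def tensor (F : ChainComplex (ModuleCat.{v} R) ℤ) (M : Type w) [AddCommGroup M] [Module R M] :
    ChainComplex (ModuleCat.{max v w} R) ℤ where
  X n := ModuleCat.of R (F.X n ⊗[R] M)
  d i j := ModuleCat.ofHom (LinearMap.rTensor M (F.d i j).hom)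
  shape i j hij := by
    rw [F.shape i j hij]
    ext : 1
    simp
  d_comp_d' i j k _ _ := by
    rw [← ModuleCat.ofHom_comp, ← LinearMap.rTensor_comp, ← ModuleCat.hom_comp, F.d_comp_d]
    ext : 1
    simp

/-- The Krull dimension of a ring as an extended real number; it is `-∞` for the zero ring. -/
def krullDim (A : Type*) [CommRing A] : EReal :=
  WithBot.recBotCoe (⊥ : EReal) (fun n : ℕ∞ => ((n : ℝ≥0∞) : EReal)) (ringKrullDim A)

/-- `inf H(X)_𝔭`, the least `n` with `H_n(X)_𝔭 ≠ 0`; it is `∞` if there is no such `n`, and `-∞`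
if such `n` are not bounded below. -/
def infHomologyAt (X : ChainComplex (ModuleCat.{v} R) ℤ) (p : PrimeSpectrum R) : EReal :=
  ⨅ (n : ℤ) (_ : Nontrivial (LocalizedModule p.asIdeal.primeCompl (X.homology n))),
    ((n : ℝ) : EReal)

/-- The dimension of a complex in the sense of Foxby,
`dim_R X = sup {dim (R/𝔭) - inf H(X)_𝔭 | 𝔭 ∈ Spec R}`. -/
def dim (X : ChainComplex (ModuleCat.{v} R) ℤ) : EReal :=
  ⨆ p : PrimeSpectrum R, krullDim (R ⧸ p.asIdeal) - infHomologyAt X p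

variable (R) in
/-- `depth_R M = inf {n | Ext^n_R(k, M) ≠ 0}`, where `k` is the residue field of the local
ring `R`. The two modules are lifted to a common universe. -/
def depth [IsLocalRing R] (M : Type w) [AddCommGroup M] [Module R M] : ℕ∞ :=
  ⨅ (n : ℕ) (_ : Nontrivial (Abelian.Ext
      (ModuleCat.of R (ULift.{w} (IsLocalRing.ResidueField R)))
      (ModuleCat.of R (ULift.{u} M)) n)), (n : ℕ∞)

/-- A system of parameters of a (Noetherian) local ring: a sequence of `dim R` elements that
generates an ideal primary to the maximal ideal. -/
def IsSystemOfParameters [IsLocalRing R] (rs : List R) : Prop :=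
  (rs.length : WithBot ℕ∞) = ringKrullDim R ∧
    (Ideal.ofList rs).radical = IsLocalRing.maximalIdeal R

variable (R) in
/-- A big Cohen-Macaulay module: `depth_R M = dim R` and `𝔪 M ≠ M`. -/
structure IsBigCohenMacaulay [IsLocalRing R] (M : Type w) [AddCommGroup M] [Module R M] :
    Prop where
  depth_eq : (depth R M : WithBot ℕ∞) = ringKrullDim R
  smul_top_ne : IsLocalRing.maximalIdeal R • (⊤ : Submodule R M) ≠ ⊤

variable (R) in
/-- A big Cohen-Macaulay module is balanced if every system of parameters of `R` is an
`M`-regular sequence. -/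
structure IsBalancedBigCohenMacaulay [IsLocalRing R] (M : Type w) [AddCommGroup M]
    [Module R M] : Prop extends IsBigCohenMacaulay R M where
  isRegular : ∀ rs : List R, IsSystemOfParameters rs → RingTheory.Sequence.IsRegular M rs

end FreeComplex

end

namespace FreeComplex

/-! ### Acyclicity up to denominators -/

open RingTheory.Sequence

/-! The vanishing of H_i(F ⊗ M)_p for i ≥ 1 is proved by induction on the prime p; p = 𝔪 is the
theorem. Put s = dim R - dim R/p. The dimension hypothesis makes H(Hom(F, R))_p vanish below degree
-s, so F_p is split exact above degree s (`exists_homotopy_of_dual_exact`), and so is F_p ⊗ M. Some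
s elements of p form part of a system of parameters (`exists_isSystemOfParameters_append`), hence
are weakly regular on M. By induction the positive homology at p dies at all smaller primes, so
elements of p act on it nilpotently (`exists_smul_pow_smul_mem_range`). The acyclicity lemma
`exists_smul_eq_of_isWeaklyRegular` then applies. Localization is replaced throughout by multipliers
from a submonoid. -/

/-- The acyclicity lemma of Peskine and Szpiro, up to multiplication by elements of a submonoid. -/
theorem exists_smul_eq_of_isWeaklyRegular {R : Type u} [CommRing R] (S : Submonoid R)
    (rs : List R) :
    ∀ (C : ℕ → Type w) [∀ n, AddCommGroup (C n)] [∀ n, Module R (C n)]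
      (d : ∀ n, C (n + 1) →ₗ[R] C n) (_ : ∀ n z, d n (d (n + 1) z) = 0)
      (_ : ∀ n, IsWeaklyRegular (C n) rs)
      (_ : ∀ n, rs.length ≤ n → ∃ T ∈ S, ∃ (h : C n →ₗ[R] C (n + 1))
        (h' : C (n + 1) →ₗ[R] C (n + 2)), ∀ z, h (d n z) + d (n + 1) (h' z) = T • z)
      (_ : ∀ n z, d n z = 0 → ∀ x ∈ rs, ∃ t ∈ S, ∃ (k : ℕ) (y : C (n + 2)),
        t • x ^ k • z = d (n + 1) y)
      (n : ℕ) (z : C (n + 1)), d n z = 0 → ∃ t ∈ S, ∃ y : C (n + 2), t • z = d (n + 1) y := by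
  induction rs with
  | nil =>
    intro C _ _ d _ _ hh _ n z hz
    obtain ⟨T, hT, h, h', H⟩ := hh n (Nat.zero_le n)
    exact ⟨T, hT, h' z, by rw [← H z, hz, map_zero, zero_add]⟩
  | cons x rs ih =>
    intro C _ _ d hd hreg hh htors n z hz
    have hx : ∀ n, IsSMulRegular (C n) x := fun n ↦ ((isWeaklyRegular_cons_iff _ _ _).1 (hreg n)).1
    have mk_eq : ∀ {n} {z : C n}, (Submodule.Quotient.mk z : QuotSMulTop x (C n)) = 0 →
        ∃ u, z = x • u := by
      intro n z h
      rw [Submodule.Quotient.mk_eq_zero, Submodule.mem_smul_pointwise_iff_exists] at h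
      obtain ⟨u, -, rfl⟩ := h
      exact ⟨u, rfl⟩
    -- H_i(C/xC) sits between H_i(C) and H_{i-1}(C), and H_0(C) is uncontrolled. Hence the shift by
    -- one, which matches the shorter sequence.
    have key := ih (fun n ↦ QuotSMulTop x (C (n + 1))) (fun n ↦ QuotSMulTop.map x (d (n + 1)))
      (fun n z ↦ by
        obtain ⟨z, rfl⟩ := Submodule.Quotient.mk_surjective _ z
        rw [QuotSMulTop.map_apply_mk, QuotSMulTop.map_apply_mk, hd, Submodule.Quotient.mk_zero])
      (fun n ↦ ((isWeaklyRegular_cons_iff _ _ _).1 (hreg (n + 1))).2)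
      (fun n hn ↦ by
        obtain ⟨T, hT, h, h', H⟩ := hh (n + 1) (Nat.succ_le_succ hn)
        refine ⟨T, hT, QuotSMulTop.map x h, QuotSMulTop.map x h', fun z ↦ ?_⟩
        obtain ⟨z, rfl⟩ := Submodule.Quotient.mk_surjective _ z
        simp only [QuotSMulTop.map_apply_mk]
        rw [← Submodule.Quotient.mk_add, H, Submodule.Quotient.mk_smul])
      (fun n z hz y hy ↦ by
        obtain ⟨z, rfl⟩ := Submodule.Quotient.mk_surjective _ z
        rw [QuotSMulTop.map_apply_mk] at hz
        obtain ⟨a, ha⟩ := mk_eq hz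
        -- The connecting map sends the class of z to that of a.
        have hda : d n a = 0 := hx n (by
          show x • d n a = x • 0
          rw [smul_zero, ← map_smul, ← ha, hd])
        obtain ⟨t, ht, k, c, hc⟩ := htors n a hda y (List.mem_cons_of_mem _ hy)
        have hcyc : d (n + 1) (t • y ^ k • z - x • c) = 0 := by
          rw [map_sub, map_smul, map_smul, map_smul, ha, ← hc, sub_eq_zero, smul_comm _ x,
            smul_comm t x]
        obtain ⟨t', ht', l, v, hv⟩ := htors (n + 1) _ hcyc y (List.mem_cons_of_mem _ hy)
        refine ⟨t' * t, S.mul_mem ht' ht, l + k, Submodule.Quotient.mk v, ?_⟩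
        rw [QuotSMulTop.map_apply_mk, ← hv, ← sub_eq_zero, ← Submodule.Quotient.mk_smul,
          ← Submodule.Quotient.mk_smul, ← Submodule.Quotient.mk_sub,
          Submodule.Quotient.mk_eq_zero, Submodule.mem_smul_pointwise_iff_exists]
        exact ⟨t' • y ^ l • c, trivial, by module⟩)
    obtain ⟨t, ht, k, y, hy⟩ := htors n z hz x List.mem_cons_self
    induction k generalizing t y with
    | zero => exact ⟨t, ht, y, by simpa using hy⟩
    | succ k ihk =>
      -- Since d y is divisible by x, y is a cycle mod x, hence a boundary mod x up to t'.
      -- Cancelling x lowers the exponent.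
      have hy0 : QuotSMulTop.map x (d (n + 1)) (Submodule.Quotient.mk y) = 0 := by
        rw [QuotSMulTop.map_apply_mk, ← hy, Submodule.Quotient.mk_eq_zero,
          Submodule.mem_smul_pointwise_iff_exists]
        exact ⟨t • x ^ k • z, trivial, by module⟩
      obtain ⟨t', ht', v, hv⟩ := key n _ hy0
      obtain ⟨v, rfl⟩ := Submodule.Quotient.mk_surjective _ v
      rw [QuotSMulTop.map_apply_mk, ← Submodule.Quotient.mk_smul, ← sub_eq_zero,
        ← Submodule.Quotient.mk_sub] at hv
      obtain ⟨a, ha⟩ := mk_eq hv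
      refine ihk (t' * t) (S.mul_mem ht' ht) a (hx _ ?_)
      show x • (t' * t) • x ^ k • z = x • d (n + 1) a
      rw [← map_smul, ← ha, map_sub, hd, sub_zero, map_smul, ← hy]
      module

/-- If the dual of a bounded complex of finite free modules is exact in degrees `> s` up to
multiplication by elements of `S`, then the complex is contractible in these degrees, up to
multiplication by elements of `S`. -/
theorem exists_homotopy_of_dual_exact {R : Type u} [CommRing R] (S : Submonoid R)
    (P : ℕ → Type v) [∀ n, AddCommGroup (P n)] [∀ n, Module R (P n)] [∀ n, Module.Free R (P n)]
    [∀ n, Module.Finite R (P n)] (d : ∀ n, P (n + 1) →ₗ[R] P n)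
    (hd : ∀ n z, d n (d (n + 1) z) = 0) (b : ℕ) (hb : ∀ n, b < n → Subsingleton (P n)) (s : ℕ)
    (hs : ∀ n, s ≤ n → ∀ f : P (n + 1) →ₗ[R] R, f ∘ₗ d (n + 1) = 0 →
      ∃ t ∈ S, ∃ g : P n →ₗ[R] R, t • f = g ∘ₗ d n) (n : ℕ) (hn : s ≤ n) :
    ∃ T ∈ S, ∃ (h : P n →ₗ[R] P (n + 1)) (h' : P (n + 1) →ₗ[R] P (n + 2)),
      ∀ z, h (d n z) + d (n + 1) (h' z) = T • z := by
  suffices ∀ m n, s ≤ n → b ≤ n + m → ∃ T ∈ S, ∃ (h : P n →ₗ[R] P (n + 1))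
      (h' : P (n + 1) →ₗ[R] P (n + 2)), ∀ z, h (d n z) + d (n + 1) (h' z) = T • z from
    this b n hn (Nat.le_add_left b n)
  intro m
  induction m with
  | zero =>
    intro n _ hbn
    have := hb (n + 1) (by omega)
    exact ⟨1, S.one_mem, 0, 0, fun z ↦ Subsingleton.elim _ _⟩
  | succ m ih =>
    intro n hn hbn
    obtain ⟨T, hT, h₁, h₂, H⟩ := ih (n + 1) (by omega) (by omega)
    -- φ kills boundaries, so its coordinates are cocycles of the dual and factor through d n up to
    -- denominators t j.
    let φ : P (n + 1) →ₗ[R] P (n + 1) := T • LinearMap.id - d (n + 1) ∘ₗ h₁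
    have hφ : φ ∘ₗ d (n + 1) = 0 := by
      ext z
      have := congrArg (d (n + 1)) (H z)
      rw [map_add, hd, add_zero, map_smul] at this
      simp [φ, this]
    let B := Module.Free.chooseBasis R (P (n + 1))
    have hB : ∀ j, ∃ t ∈ S, ∃ g : P n →ₗ[R] R, t • (B.coord j ∘ₗ φ) = g ∘ₗ d n := fun j ↦
      hs n hn _ (by rw [LinearMap.comp_assoc, hφ, LinearMap.comp_zero])
    choose t ht g hg using hB
    classical
    refine ⟨(∏ j, t j) * T, S.mul_mem (S.prod_mem fun j _ ↦ ht j) hT,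
      ∑ j, (∏ i ∈ Finset.univ.erase j, t i) • (g j).smulRight (B j), (∏ j, t j) • h₁,
      fun z ↦ ?_⟩
    have h1 : (∑ j, (∏ i ∈ Finset.univ.erase j, t i) • (g j).smulRight (B j)) (d n z) =
        (∏ j, t j) • φ z := by
      conv_rhs => rw [← B.sum_repr (φ z), Finset.smul_sum]
      rw [LinearMap.sum_apply]
      refine Finset.sum_congr rfl fun j _ ↦ ?_
      have hj : t j • B.repr (φ z) j = g j (d n z) := by
        simpa using LinearMap.congr_fun (hg j) z
      rw [LinearMap.smul_apply, LinearMap.smulRight_apply, ← hj,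
        ← Finset.prod_erase_mul _ _ (Finset.mem_univ j)]
      simp only [smul_eq_mul]
      module
    rw [h1]
    simp [φ, smul_sub, mul_smul]

/-! ### Systems of parameters adapted to a prime -/

section SystemOfParameters

variable {R : Type u} [CommRing R]

theorem ringKrullDim_quotient_eq_coheight (p : PrimeSpectrum R) :
    ringKrullDim (R ⧸ p.asIdeal) = Order.coheight p := by
  rw [ringKrullDim_quotient, Order.coheight_eq_krullDim_Ici]
  rfl

variable [IsNoetherianRing R]

/-- Prime avoidance: an element of `𝔞` that lowers the dimension of `R ⧸ J`. -/
theorem exists_mem_coheight_le (J 𝔞 : Ideal R) (j : ℕ)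
    (hJ : ∀ q : PrimeSpectrum R, J ≤ q.asIdeal → Order.coheight q ≤ (j + 1 : ℕ))
    (h𝔞 : ∀ q : PrimeSpectrum R, 𝔞 ≤ q.asIdeal → Order.coheight q ≤ j) :
    ∃ x ∈ 𝔞, ∀ q : PrimeSpectrum R, J ⊔ Ideal.span {x} ≤ q.asIdeal → Order.coheight q ≤ j := by
  -- Minimal primes of J containing 𝔞 already satisfy the bound, so only the others must be avoided.
  let s : Set (Ideal R) := {q | q ∈ J.minimalPrimes ∧ ¬ 𝔞 ≤ q}
  have hs : s.Finite := (J.finite_minimalPrimes_of_isNoetherianRing R).subset fun _ h ↦ h.1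
  have hx : ¬ ((𝔞 : Set R) ⊆ ⋃ q ∈ s, q) := fun h ↦ by
    obtain ⟨q, hq, hle⟩ := (Ideal.subset_union_prime_finite hs (f := id) ⊥ ⊥
      (fun q hq _ _ ↦ hq.1.1.1)).1 h
    exact hq.2 hle
  obtain ⟨x, hxa, hxs⟩ := Set.not_subset.1 hx
  refine ⟨x, hxa, fun q hq ↦ ?_⟩
  obtain ⟨q', hq', hle⟩ := Ideal.exists_minimalPrimes_le (le_sup_left.trans hq)
  by_cases h : 𝔞 ≤ q'
  · exact h𝔞 q (h.trans hle)
  · have hxq' : x ∉ q' := fun hmem ↦ hxs (Set.mem_biUnion (show q' ∈ s from ⟨hq', h⟩) hmem)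
    let Q : PrimeSpectrum R := ⟨q', hq'.1.1⟩
    have hlt : Q < q := lt_of_le_of_ne hle fun e ↦ hxq' (by
      change x ∈ Q.asIdeal
      rw [e]
      exact hq (Ideal.mem_sup_right (Ideal.mem_span_singleton_self x)))
    have := (Order.coheight_add_one_le hlt).trans (hJ Q hq'.1.2)
    rw [Nat.cast_add, Nat.cast_one] at this
    exact (ENat.add_le_add_iff_right ENat.one_ne_top).1 this

theorem exists_list_coheight_le (𝔞 : Ideal R) (j : ℕ)
    (h𝔞 : ∀ q : PrimeSpectrum R, 𝔞 ≤ q.asIdeal → Order.coheight q ≤ j) (k : ℕ) :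
    ∀ J : Ideal R, (∀ q : PrimeSpectrum R, J ≤ q.asIdeal → Order.coheight q ≤ (j + k : ℕ)) →
    ∃ xs : List R, xs.length = k ∧ (∀ x ∈ xs, x ∈ 𝔞) ∧
      ∀ q : PrimeSpectrum R, J ⊔ Ideal.ofList xs ≤ q.asIdeal → Order.coheight q ≤ j := by
  induction k with
  | zero => exact fun J hJ ↦ ⟨[], rfl, by simp, by simpa using hJ⟩
  | succ k ih =>
    intro J hJ
    obtain ⟨x, hx, h⟩ := exists_mem_coheight_le J 𝔞 (j + k) hJ
      fun q hq ↦ (h𝔞 q hq).trans (by exact_mod_cast Nat.le_add_right j k)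
    obtain ⟨xs, hl, hxs, h'⟩ := ih _ h
    refine ⟨x :: xs, by simp [hl], by simpa using ⟨hx, hxs⟩, ?_⟩
    rwa [Ideal.ofList_cons, ← sup_assoc]

/-- A prime `p` contains `dim R - dim R ⧸ p` elements of a system of parameters. -/
theorem exists_isSystemOfParameters_append [IsLocalRing R] (p : PrimeSpectrum R) (s e : ℕ)
    (he : Order.coheight p = e) (hd : ringKrullDim R = (s + e : ℕ)) :
    ∃ xs ys : List R, xs.length = s ∧ (∀ x ∈ xs, x ∈ p.asIdeal) ∧
      IsSystemOfParameters (xs ++ ys) := by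
  obtain ⟨xs, hxl, hxp, hx⟩ := exists_list_coheight_le p.asIdeal e
    (fun q hq ↦ he ▸ Order.coheight_anti hq) s ⊥ (fun q _ ↦ by
      have := Order.coheight_le_krullDim q
      rw [← ringKrullDim, hd] at this
      rw [add_comm]
      exact_mod_cast this)
  have hmax : ∀ q : PrimeSpectrum R,
      IsLocalRing.maximalIdeal R ≤ q.asIdeal ↔ Order.coheight q ≤ (0 : ℕ) := fun q ↦ by
    rw [Nat.cast_zero, nonpos_iff_eq_zero, Order.coheight_eq_zero]
    refine ⟨fun h q' _ ↦ (IsLocalRing.le_maximalIdeal q'.2.ne_top).trans h, fun h ↦ ?_⟩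
    exact h (b := IsLocalRing.closedPoint R) (IsLocalRing.le_maximalIdeal q.2.ne_top)
  obtain ⟨ys, hyl, hym, hy⟩ := exists_list_coheight_le (IsLocalRing.maximalIdeal R) 0
    (fun q ↦ (hmax q).1) e (Ideal.ofList xs) (by simpa using hx)
  refine ⟨xs, ys, hxl, hxp, ?_, ?_⟩
  · rw [hd, List.length_append, hxl, hyl]
  · rw [Ideal.ofList_append]
    apply le_antisymm
    · refine (IsLocalRing.maximalIdeal.isMaximal R).isPrime.isRadical.radical_le_iff.2
        (sup_le (Ideal.span_le.2 fun x hx ↦ ?_) (Ideal.span_le.2 hym))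
      exact IsLocalRing.le_maximalIdeal p.2.ne_top (hxp x hx)
    · rw [Ideal.radical_eq_sInf]
      exact le_sInf fun q hq ↦ (hmax ⟨q, hq.2⟩).2 (hy ⟨q, hq.2⟩ hq.1)

end SystemOfParameters

/-! ### Localized homology and the dimension hypothesis -/

variable {R : Type u} [CommRing R]

theorem exists_smul_eq_of_subsingleton_homology (S : Submonoid R)
    (X : ChainComplex (ModuleCat.{v} R) ℤ) (n : ℤ)
    (h : Subsingleton (LocalizedModule S (X.homology n))) (z : X.X n)
    (hz : (X.d n (n - 1)).hom z = 0) :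
    ∃ t ∈ S, ∃ y : X.X (n + 1), t • z = (X.d (n + 1) n).hom y := by
  let Y := X.sc' (n + 1) n (n - 1)
  let e : X.homology n ≅ Y.moduleCatLeftHomologyData.H :=
    ShortComplex.homologyMapIso (X.isoSc' (n + 1) n (n - 1) (by simp) (by simp)) ≪≫
      Y.moduleCatHomologyIso
  let c : Y.moduleCatLeftHomologyData.H :=
    Submodule.Quotient.mk (⟨z, hz⟩ : LinearMap.ker Y.g.hom)
  obtain ⟨t, ht, htc⟩ := LocalizedModule.subsingleton_iff.1 h (e.inv.hom c)
  have htc' : t • c = 0 := by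
    have := congrArg e.hom.hom htc
    rw [map_smul, map_zero] at this
    simpa using this
  obtain ⟨y, hy⟩ := (Submodule.Quotient.mk_eq_zero _
    (x := t • (⟨z, hz⟩ : LinearMap.ker Y.g.hom))).1 htc'
  exact ⟨t, ht, y, (congrArg Subtype.val hy).symm⟩

theorem exists_smul_eq_comp_of_subsingleton_homology_dual (S : Submonoid R)
    (F : ChainComplex (ModuleCat.{v} R) ℤ) (n i j k : ℤ) (hi : i = -(n - 1)) (hj : j = -n)
    (hk : k = -(n + 1)) (h : Subsingleton (LocalizedModule S ((dual F).homology n)))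
    (f : F.X j →ₗ[R] R) (hf : f ∘ₗ (F.d i j).hom = 0) :
    ∃ t ∈ S, ∃ g : F.X k →ₗ[R] R, t • f = g ∘ₗ (F.d j k).hom := by
  subst hi hj hk
  exact exists_smul_eq_of_subsingleton_homology S (dual F) n h f hf

theorem krullDim_eq_of_ringKrullDim_eq {A : Type*} [CommRing A] {n : ℕ}
    (h : ringKrullDim A = n) : krullDim A = ((n : ℝ) : EReal) := by
  rw [krullDim, h]
  change (((n : ℕ∞) : ℝ≥0∞) : EReal) = _
  rw [ENat.toENNReal_coe, ← ENNReal.coe_natCast, EReal.coe_nnreal_eq_coe_real, NNReal.coe_natCast]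

theorem subsingleton_homology_dual_of_dim_le {X : ChainComplex (ModuleCat.{v} R) ℤ}
    (hdim : 0 ≤ krullDim R - dim X) (p : PrimeSpectrum R) {c e : ℕ}
    (hd : ringKrullDim R = c) (he : Order.coheight p = e) (n : ℤ) (hn : (c : ℤ) < e - n) :
    Subsingleton (LocalizedModule p.asIdeal.primeCompl (X.homology n)) := by
  by_contra hne
  rw [not_subsingleton_iff_nontrivial] at hne
  rw [krullDim_eq_of_ringKrullDim_eq hd] at hdim
  have h1 : dim X ≤ ((c : ℝ) : EReal) := by
    rwa [EReal.sub_nonneg (.inl (EReal.coe_ne_top _)) (.inl (EReal.coe_ne_bot _))] at hdim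
  have h2 : krullDim (R ⧸ p.asIdeal) - infHomologyAt X p ≤ ((c : ℝ) : EReal) :=
    (le_iSup (fun p : PrimeSpectrum R ↦ krullDim (R ⧸ p.asIdeal) - infHomologyAt X p) p).trans h1
  have h3 : infHomologyAt X p ≤ ((n : ℝ) : EReal) := iInf₂_le n hne
  rw [krullDim_eq_of_ringKrullDim_eq (n := e) (by
    rw [ringKrullDim_quotient_eq_coheight, he]; rfl)] at h2
  have h4 := (EReal.sub_le_sub le_rfl h3).trans h2
  rw [← EReal.coe_sub, EReal.coe_le_coe_iff] at h4
  have h5 : (e : ℤ) - n ≤ c := by exact_mod_cast h4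
  omega

/-- The elements of a prime `p` act on `z` nilpotently up to `range f` and up to multiplication by
elements outside `p`, if `z` vanishes in the cokernel of `f` at the primes strictly below `p`. -/
theorem exists_smul_pow_smul_mem_range {N N' : Type*} [AddCommGroup N] [AddCommGroup N']
    [Module R N] [Module R N'] (f : N' →ₗ[R] N) (z : N) (p : PrimeSpectrum R)
    (h : ∀ q < p, ∃ t ∈ q.asIdeal.primeCompl, ∃ y, t • z = f y) (x : R) (hx : x ∈ p.asIdeal) :
    ∃ t ∈ p.asIdeal.primeCompl, ∃ (k : ℕ) (y : N'), t • x ^ k • z = f y := by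
  by_contra! hcon
  -- I is the annihilator of z modulo the range. If it misses all t * x ^ k, it lies in a prime
  -- inside p that avoids x, against `h`.
  let I : Ideal R := (LinearMap.range f).comap (LinearMap.toSpanSingleton R N z)
  have hI : ∀ r, r ∈ I ↔ ∃ y, f y = r • z := fun r ↦ by simp [I]
  obtain ⟨q, hq, hIq, hdis⟩ := Ideal.exists_le_prime_disjoint I
    (p.asIdeal.primeCompl ⊔ Submonoid.powers x) (by
      rw [Set.disjoint_left]
      intro r hr hr'
      obtain ⟨t, ht, _, ⟨k, rfl⟩, rfl⟩ := Submonoid.mem_sup.1 hr'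
      obtain ⟨y, hy⟩ := (hI _).1 hr
      exact hcon t ht k y (by rw [hy, mul_smul]))
  rw [Set.disjoint_left] at hdis
  have hqp : q ≤ p.asIdeal := fun r hr ↦ by
    by_contra hrp
    exact hdis hr (SetLike.le_def.1 le_sup_left hrp)
  have hxq : x ∉ q := fun hr ↦
    hdis hr (SetLike.le_def.1 le_sup_right (Submonoid.mem_powers x))
  obtain ⟨t, ht, y, hy⟩ := h ⟨q, hq⟩ (lt_of_le_of_ne hqp fun e ↦
    hxq ((congrArg PrimeSpectrum.asIdeal e).ge hx))
  exact ht (hIq ((hI t).2 ⟨y, hy.symm⟩))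

/-! ### Induction on primes -/

theorem exists_smul_eq_of_isBalancedBigCohenMacaulay [IsLocalRing R] [IsNoetherianRing R]
    (F : ChainComplex (ModuleCat.{v} R) ℤ) (b : ℕ) (hF : IsFiniteFree F 0 b)
    (hdim : 0 ≤ krullDim R - dim (dual F)) (M : Type w) [AddCommGroup M] [Module R M]
    (hM : IsBalancedBigCohenMacaulay R M) (p : PrimeSpectrum R) :
    ∀ (n : ℕ) (z : F.X (n + 1 : ℕ) ⊗[R] M),
      LinearMap.rTensor M (F.d (n + 1 : ℕ) n).hom z = 0 → ∃ t ∈ p.asIdeal.primeCompl,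
        ∃ y, t • z = LinearMap.rTensor M (F.d (n + 1 + 1 : ℕ) (n + 1 : ℕ)).hom y := by
  have : WellFoundedLT (PrimeSpectrum R) := StrictMono.wellFoundedLT (f := Order.height)
    fun _ _ h ↦ Order.height_strictMono h
      (WithBot.coe_lt_coe.1 ((Order.height_le_krullDim _).trans_lt ringKrullDim_lt_top))
  induction p using WellFoundedLT.induction with
  | ind p ih =>
  obtain ⟨e, he⟩ := ENat.ne_top_iff_exists.1 (Order.coheight_lt_top p).ne
  obtain ⟨c, hc⟩ : ∃ c : ℕ, ringKrullDim R = c :=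
    ⟨_, (Order.krullDim_eq_length_of_finiteDimensionalOrder (α := PrimeSpectrum R))⟩
  obtain ⟨s, rfl⟩ : ∃ s, c = s + e := by
    have := Order.coheight_le_krullDim p
    rw [← ringKrullDim, hc, ← he] at this
    obtain ⟨s, hs⟩ := Nat.exists_eq_add_of_le (show e ≤ c by exact_mod_cast this)
    exact ⟨s, hs.trans (Nat.add_comm _ _)⟩
  obtain ⟨xs, ys, hxl, hxp, hsop⟩ := exists_isSystemOfParameters_append p s e he.symm hc
  have hreg := ((RingTheory.Sequence.isWeaklyRegular_append_iff M xs ys).1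
    (hM.isRegular _ hsop).toIsWeaklyRegular).1
  have := hF.free
  have := hF.finite
  have hdd : ∀ (n : ℕ) z, (F.d (n + 1 : ℕ) n).hom ((F.d (n + 1 + 1 : ℕ) (n + 1 : ℕ)).hom z) = 0 :=
    fun n z ↦ by
      rw [← LinearMap.comp_apply, ← ModuleCat.hom_comp, F.d_comp_d]
      rfl
  have hdd' : ∀ (n : ℕ) z, LinearMap.rTensor M (F.d (n + 1 : ℕ) n).hom
      (LinearMap.rTensor M (F.d (n + 1 + 1 : ℕ) (n + 1 : ℕ)).hom z) = 0 := fun n z ↦ by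
    rw [← LinearMap.comp_apply, ← LinearMap.rTensor_comp, ← ModuleCat.hom_comp, F.d_comp_d]
    simp
  refine exists_smul_eq_of_isWeaklyRegular p.asIdeal.primeCompl xs (fun n : ℕ ↦ F.X n ⊗[R] M)
    (fun n ↦ LinearMap.rTensor M (F.d (n + 1 : ℕ) n).hom) hdd'
    (fun n ↦ hreg.isWeaklyRegular_lTensor) (fun n hn ↦ ?_)
    (fun n z hz x hx ↦ exists_smul_pow_smul_mem_range _ z p (fun q hq ↦ ih q hq n z hz) x
      (hxp x hx))
  -- For n ≥ s the dual is needed in degree -(n + 1), where e + (n + 1) exceeds dim R = s + e.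
  obtain ⟨T, hT, h, h', H⟩ := exists_homotopy_of_dual_exact p.asIdeal.primeCompl
    (fun n : ℕ ↦ F.X n) (fun n ↦ (F.d (n + 1 : ℕ) n).hom) hdd b
    (fun n hn ↦ hF.zero_of_gt n (by exact_mod_cast hn)) s
    (fun n hn ↦ exists_smul_eq_comp_of_subsingleton_homology_dual _ F (-(n + 1 : ℕ)) _ _ _
      (by push_cast; ring) (by simp) (by push_cast; ring)
      (subsingleton_homology_dual_of_dim_le hdim p hc he.symm _ (by push_cast; omega)))
    n (hxl ▸ hn)
  refine ⟨T, hT, LinearMap.rTensor M h, LinearMap.rTensor M h', fun z ↦ ?_⟩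
  have H' : h ∘ₗ (F.d (n + 1 : ℕ) n).hom + (F.d (n + 1 + 1 : ℕ) (n + 1 : ℕ)).hom ∘ₗ h' =
      T • LinearMap.id := LinearMap.ext H
  have := LinearMap.congr_fun (congrArg (LinearMap.rTensor M) H') z
  simpa only [LinearMap.rTensor_add, LinearMap.rTensor_comp, LinearMap.rTensor_smul,
    LinearMap.rTensor_id, LinearMap.add_apply, LinearMap.comp_apply, LinearMap.smul_apply,
    LinearMap.id_apply] using this

end FreeComplex

theorem mainTheorem6 {R : Type u} [CommRing R] [IsLocalRing R] [IsNoetherianRing R]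
    (F : ChainComplex (ModuleCat.{v} R) ℤ) (b : ℕ) (hF : FreeComplex.IsFiniteFree F 0 b)
    (hdim : 0 ≤ FreeComplex.krullDim R - FreeComplex.dim (FreeComplex.dual F))
    (M : Type w) [AddCommGroup M] [Module R M]
    (hM : FreeComplex.IsBalancedBigCohenMacaulay R M) (i : ℤ) (hi : 1 ≤ i) :
    Limits.IsZero ((FreeComplex.tensor F M).homology i) := by
  obtain ⟨n, rfl⟩ : ∃ n : ℕ, i = (n + 1 : ℕ) := ⟨(i - 1).toNat, by omega⟩
  rw [← HomologicalComplex.exactAt_iff_isZero_homology,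
    HomologicalComplex.exactAt_iff' _ ((n + 1 + 1 : ℕ) : ℤ) _ (n : ℤ) (by simp) (by simp),
    ShortComplex.moduleCat_exact_iff]
  intro z hz
  obtain ⟨t, ht, y, hy⟩ := FreeComplex.exists_smul_eq_of_isBalancedBigCohenMacaulay F b hF hdim M hM
    (IsLocalRing.closedPoint R) n z hz
  obtain ⟨u, rfl⟩ : IsUnit t := IsLocalRing.notMem_maximalIdeal.1 ht
  refine ⟨u⁻¹ • y, ?_⟩
  change LinearMap.rTensor M (F.d (n + 1 + 1 : ℕ) (n + 1 : ℕ)).hom (u⁻¹ • y) = z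
  rw [LinearMap.map_smul_of_tower, ← hy]
  exact inv_smul_smul u z
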